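/- **Setting.** Let $q$ be a prime power and $n\ge 2$. Write $F=\mathrm{GF}(q)$, $K=\mathrm{GF}(q^2)$ and $\theta_{k,s}=s^k+\dots+s+1$. Let $V$ be a $2n$-dimensional vector space over $K$ with a non-degenerate alternating $K$-bilinear form $b$. Regard $V$ as a $4n$-dimensional vector space over $F$, and let $\Sigma=\mathrm{PG}(4n-1,q)$ be its projective space. Dye's symplectic line spread $\mathcal F$ of $\Sigma$ consists of the one-dimensional $K$-subspaces of $V$, regarded as lines of $\Sigma$. The isometry group of $(V,b)$ preserves $\mathcal F$ and fixes the pencil of $q+1$ linear complexes $\mathcal W_i$ ($1\le i\le q+1$) of $\Sigma$ given by the $F$-bilinear alternating forms $f_c(x,y)=\mathrm{Tr}_{K/F}(c\,b(x,y))$, $c\in K\setminus\{0\}$; here forms that are proportional over $F$ give the same $\mathcal W_i$. The lines of $\mathcal F$ are totally isotropic for each $\mathcal W_i$. Embed $\Sigma$ as a Baer subgeometry in $\mathrm{PG}(4n-1,q^2)=\mathrm{PG}(K\otimes_F V)$, and let $\tau$ be the semilinear involution $a\otimes v\mapsto a^q\otimes v$, which fixes $\Sigma$ pointwise. For $\mathcal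 W_i$ given by the form $f$, extend $f$ to a $K$-bilinear form on $K\otimes_F V$. Let $\mathcal H_i$ be the non-degenerate Hermitian variety consisting of the points $\langle x\rangle$ with $f(x,\tau x)=0$, with associated polarity sending $\langle y\rangle$ to the hyperplane $\{x: f(x,\tau y)=0\}$. (The Hermitian form is $\varepsilon f(x,\tau y)$, where $\varepsilon\neq0$ and $\varepsilon^q=-\varepsilon$.) A generator of $\mathcal H_i$ is a maximal totally isotropic subspace. Let $\Sigma_1$ and $\Sigma_2=\tau(\Sigma_1)$ be the two disjoint $(2n-1)$-dimensional projective subspaces of $\mathrm{PG}(4n-1,q^2)$ that meet every extended line of $\mathcal F$. In terms of vectors, $\Sigma_1$ (respectively $\Sigma_2$) consists of the $x\in K\otimes_F V$ such that for every $c\in K$ the map $\mathrm{id}\otimes c$ sends $x$ to $c\,x$ (respectively to $c^q x$). A set $\mathcal X$ of points of $\mathcal H_i$ is called $m$-tight if, for every point $P$ of $\mathcal H_i$ with polar hyperplane $P^{\perp}$, the number $|P^{\perp}\cap\mathcal X|$ equals $m\,\theta_{2n-2,q^2}+q^{4n-2}$ when $P\in\mathcal X$ and $m\,\theta_{2n-2,q^2}$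 when $P\notin\mathcal X$. **Theorem.** For every point $P$ of $\Sigma_1$, the polar hyperplane $P^{\perp_h}$ of $P$ is the same for all the varieties $\mathcal H_1,\dots,\mathcal H_{q+1}$. With $S_P=P^{\perp_h}\cap\Sigma_2$, the subspace $\langle P,S_P\rangle$ is a generator of each $\mathcal H_i$. Let $\mathcal R$ be the set of the points that lie on $\langle P,S_P\rangle$ for some point $P$ of $\Sigma_1$. Then $\mathcal R$ is a $(q^{4n-2}+1)$-tight set of $\mathcal H_i$ for every $i$ with $1\le i\le q+1$. -/

import Mathlib

open scoped TensorProduct LinearAlgebra.Projectivization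

noncomputable section

namespace DyeSpread

/-- `θ_{k,s} = s ^ k + ⋯ + s + 1`, the number of points of `PG(k, s)`. -/
def theta (k s : ℕ) : ℕ := ∑ j ∈ Finset.range (k + 1), s ^ j

section Baer

/-! `V` is a vector space over `F = GF(q)` and `K = GF(q ^ 2)`. The points of the Baer subgeometry
`Σ = PG(V)` of `PG(K ⊗[F] V)` are those spanned by the vectors `1 ⊗ₜ v`. -/

variable {F K V : Type*} [Field F] [Fintype F] [Field K] [Algebra F K]
  [AddCommGroup V] [Module F V]

variable (F K V) in
/-- The semilinear involution `τ` of `K ⊗[F] V` fixing `Σ` pointwise: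
`a ⊗ v ↦ a ^ q ⊗ v`, with `q = |F|`. -/
def tau : K ⊗[F] V →ₗ[F] K ⊗[F] V :=
  (FiniteField.frobeniusAlgHom F K).toLinearMap.rTensor V

/-- The form `h(x, y) = f(x, τ y)` on `K ⊗[F] V` given by a bilinear form `f` on `V`
(extended `K`-bilinearly). If `f` is alternating then `h(y, x) = -h(x, y) ^ q`, so that `ε h` is a
Hermitian form for each `ε ≠ 0` with `ε ^ q = -ε`; the factor `ε` changes neither the Hermitian
variety nor its polarity. -/
def sesq (f : LinearMap.BilinForm F V) (x y : K ⊗[F] V) : K :=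
  f.baseChange K x (tau F K V y)


/-- The form `h` of an alternating form is skew-Hermitian. -/
theorem sesq_swap (hK : Module.finrank F K = 2) (f : LinearMap.BilinForm F V) (hf : f.IsAlt)
    (x y : K ⊗[F] V) : sesq f y x = -(sesq f x y) ^ Fintype.card F := by
  have : FiniteDimensional F K := Module.finite_of_finrank_eq_succ hK
  have : Finite K := Module.finite_of_finite F
  have hfr : ∀ a : K, (a ^ Fintype.card F) ^ Fintype.card F = a := by
    intro a
    have := Fintype.ofFinite K
    rw [← pow_mul, ← sq, ← hK, ← Module.card_eq_pow_finrank, FiniteField.pow_card]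
  have hadd : ∀ a c : K, (a + c) ^ Fintype.card F = a ^ Fintype.card F + c ^ Fintype.card F :=
    fun a c => map_add (FiniteField.frobeniusAlgHom F K) a c
  induction x with
  | zero => simp [sesq, Fintype.card_ne_zero]
  | add x x' hx hx' =>
    have e1 : sesq f y (x + x') = sesq f y x + sesq f y x' := by simp [sesq]
    have e2 : sesq f (x + x') y = sesq f x y + sesq f x' y := by simp [sesq]
    rw [e1, e2, hx, hx', hadd]; ring
  | tmul a v =>
    induction y with
    | zero => simp [sesq, Fintype.card_ne_zero]
    | add y y' hy hy' =>
      have e1 : sesq f (a ⊗ₜ v) (y + y') = sesq f (a ⊗ₜ v) y + sesq f (a ⊗ₜ v) y' := by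
        simp [sesq]
      have e2 : sesq f (y + y') (a ⊗ₜ[F] v) = sesq f y (a ⊗ₜ v) + sesq f y' (a ⊗ₜ v) := by
        simp [sesq]
      rw [e1, e2, hy, hy', hadd]; ring
    | tmul c w =>
      have h1 : ∀ (a c : K) (v w : V),
          sesq f (a ⊗ₜ[F] v) (c ⊗ₜ[F] w) = f v w • (a * c ^ Fintype.card F) := by
        intro a c v w; simp [sesq, tau]
      have h2 : ∀ (t : F) (a : K), (t • a) ^ Fintype.card F = t • a ^ Fintype.card F :=
        fun t a => map_smul (FiniteField.frobeniusAlgHom F K) t a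
      rw [h1, h1, h2, mul_pow, hfr, ← hf.neg_eq v w, neg_smul, mul_comm]

variable (K) in
/-- The points of the Hermitian variety of `PG(K ⊗[F] V)` that an alternating form `f` (a linear
complex of `PG(V)`) gives rise to. -/
def hermitianVariety (f : LinearMap.BilinForm F V) : Set (ℙ K (K ⊗[F] V)) :=
  {P | ∀ x ∈ P.submodule, sesq f x x = 0}

/-- The polar hyperplane `P ^ ⊥_h` of a point `P` with respect to the Hermitian variety of `f`. -/
def polar (f : LinearMap.BilinForm F V) (P : ℙ K (K ⊗[F] V)) : Submodule K (K ⊗[F] V) where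
  carrier := {x | ∀ y ∈ P.submodule, sesq f x y = 0}
  zero_mem' y _ := by simp [sesq]
  add_mem' {x x'} hx hx' y hy := by
    have h1 := hx y hy
    have h2 := hx' y hy
    simp only [sesq] at h1 h2 ⊢
    simp [h1, h2]
  smul_mem' c x hx y hy := by
    have h1 := hx y hy
    simp only [sesq] at h1 ⊢
    simp [h1]

/-- `S` is a generator of the Hermitian variety of `f`: a maximal totally isotropic subspace. -/
def IsGenerator (f : LinearMap.BilinForm F V) (S : Submodule K (K ⊗[F] V)) : Prop :=
  Maximal (fun T : Submodule K (K ⊗[F] V) => ∀ x ∈ T, ∀ y ∈ T, sesq f x y = 0) S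

/-- `X` is an `i`-tight set of the Hermitian variety `H(r, q ^ 2)` of `f`, where
`r + 1 = dim V` is even and `r ≥ 3`. -/
def IsTight (f : LinearMap.BilinForm F V) (i : ℕ) (X : Set (ℙ K (K ⊗[F] V))) : Prop :=
  let q := Fintype.card F
  let r := Module.finrank F V - 1
  X ⊆ hermitianVariety K f ∧ ∀ P ∈ hermitianVariety K f,
    (P ∈ X → Set.ncard {Q | Q ∈ X ∧ Q.submodule ≤ polar f P} =
      i * theta ((r - 3) / 2) (q ^ 2) + q ^ (r - 1)) ∧
    (P ∉ X → Set.ncard {Q | Q ∈ X ∧ Q.submodule ≤ polar f P} =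
      i * theta ((r - 3) / 2) (q ^ 2))

end Baer

section Dye

/-! Now `V` is a vector space over `K = GF(q ^ 2)`, regarded also as one over `F = GF(q)`, with an
alternating `K`-bilinear form `b`. -/

variable {F K V : Type*} [Field F] [Field K] [Algebra F K]
  [AddCommGroup V] [Module F V] [Module K V] [IsScalarTower F K V]

variable (F K V) in
/-- Dye's line spread of `PG(V)` over `F`: the one-dimensional `K`-subspaces of `V`, regarded as
two-dimensional `F`-subspaces. -/
def spread : Set (Submodule F V) :=
  {l | ∃ v : V, v ≠ 0 ∧ l = (Submodule.span K {v}).restrictScalars F}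

variable (F) in
/-- The alternating `F`-bilinear form `(x, y) ↦ Tr_{K/F} (c b(x, y))` on `V`. -/
def traceForm (b : LinearMap.BilinForm K V) (c : K) : LinearMap.BilinForm F V :=
  LinearMap.mk₂ F (fun x y => Algebra.trace F K (c * b x y))
    (fun x x' y => by simp [mul_add])
    (fun a x y => by
      rw [← algebraMap_smul K a x, map_smul, LinearMap.smul_apply, algebraMap_smul,
        mul_smul_comm, map_smul])
    (fun x y y' => by simp [mul_add])
    (fun a x y => by
      rw [← algebraMap_smul K a y, map_smul, algebraMap_smul, mul_smul_comm, map_smul])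

variable (F) in
/-- The forms of the pencil of linear complexes `W_i` of `PG(V)` over `F` that is fixed by the
isometry group of `b`. Forms that are proportional over `F` give the same linear complex, so
there are `q + 1` complexes. -/
def pencil (b : LinearMap.BilinForm K V) : Set (LinearMap.BilinForm F V) :=
  {f | ∃ c : K, c ≠ 0 ∧ f = traceForm F b c}

/-- The forms of the pencil are exactly the nonzero alternating `F`-bilinear forms on `V` that are
invariant under the isometry group of `b`. -/
theorem mem_pencil_iff [Finite F] (hK : Module.finrank F K = 2) [FiniteDimensional K V]
    [Nontrivial V] (b : LinearMap.BilinForm K V) (hb : b.IsAlt) (hbn : b.Nondegenerate)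
    (f : LinearMap.BilinForm F V) :
    f ∈ pencil F b ↔ f ≠ 0 ∧ f.IsAlt ∧
      ∀ g : V ≃ₗ[K] V, (∀ x y, b (g x) (g y) = b x y) → ∀ x y, f (g x) (g y) = f x y := by
  have : FiniteDimensional F K := Module.finite_of_finrank_eq_succ hK
  have htr := traceForm_nondegenerate F K
  have hex : ∀ u : V, u ≠ 0 → ∃ y, b u y = 1 := by
    intro u hu
    by_contra! h
    refine hu (hbn.1 u fun y => ?_)
    by_contra hy
    exact h ((b u y)⁻¹ • y) (by simp [hy])
  have htr0 : ∀ a : K, (∀ c, Algebra.trace F K (a * c) = 0) → a = 0 := fun a h => htr.1 a h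
  constructor
  · rintro ⟨c, hc, rfl⟩
    refine ⟨fun h0 => ?_, fun x => by simp [traceForm, hb x], fun g hg x y => by
      simp [traceForm, hg]⟩
    obtain ⟨u, hu⟩ := exists_ne (0 : V)
    obtain ⟨y, hy⟩ := hex u hu
    refine hc (htr0 c fun d => ?_)
    have := LinearMap.congr_fun₂ h0 u (d • y)
    simpa [traceForm, hy] using this
  · rintro ⟨hf0, hfa, hinv⟩
    have hA : ∀ (c : K) (u y : V), b u y = 0 → f (c • u) y = 0 := by
      intro c u y huy
      by_cases hu : u = 0
      · simp [hu]
      obtain ⟨x, hx⟩ := hex u hu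
      let t : V ≃ₗ[K] V := LinearEquiv.transvection (f := b u) (v := c • u) (by simp [hb u])
      have ht : ∀ z, t z = z + b u z • c • u := fun z => by
        simp [t, LinearMap.transvection.apply]
      have h := hinv t (fun z w => by
        have h1 := hb.neg_eq u z
        simp [ht, hb u, ← h1]; ring) x y
      simpa [ht, hx, huy] using h
    have hadj : ∀ (c : K) (u y : V), f (c • u) y = f u (c • y) := by
      intro c u y
      have h1 := hA c (u + y) (u + y) (hb _)
      have h2 := hA c u u (hb _)
      have h3 := hA c y y (hb _)
      have h4 := hfa.neg_eq (c • y) u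
      simp only [smul_add, map_add, LinearMap.add_apply, h2, h3] at h1
      rw [← h4]
      linear_combination h1
    have hlam : ∀ u : V, u ≠ 0 → ∃ a : K, ∀ y, f u y = Algebra.trace F K (a * b u y) := by
      intro u hu
      obtain ⟨w, hw⟩ := hex u hu
      let φ : Module.Dual F K := f u ∘ₗ (LinearMap.toSpanSingleton K V w).restrictScalars F
      refine ⟨((Algebra.traceForm F K).toDual htr).symm φ, fun y => ?_⟩
      have h1 : Algebra.traceForm F K (((Algebra.traceForm F K).toDual htr).symm φ) (b u y)
          = φ (b u y) := LinearMap.BilinForm.apply_toDual_symm_apply ..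
      rw [Algebra.traceForm_apply] at h1
      rw [h1]
      have h2 := hA 1 u (y - b u y • w) (by simp [hw])
      rw [one_smul, map_sub, sub_eq_zero] at h2
      simpa [φ] using h2
    have hsame : ∀ (u y : V) (a a' : K), (∀ z, f u z = Algebra.trace F K (a * b u z)) →
        (∀ z, f y z = Algebra.trace F K (a' * b y z)) → b u y ≠ 0 → a = a' := by
      intro u y a a' h h' huy
      rw [← sub_eq_zero]
      refine htr0 _ fun d => ?_
      have h1 := h ((d / b u y) • y)
      have h2 := h' ((d / b u y) • u)
      have h3 := hfa.neg_eq y ((d / b u y) • u)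
      have h4 := hadj (d / b u y) u y
      have h5 := hb.neg_eq u y
      have e1 : a * b u ((d / b u y) • y) = a * d := by
        rw [map_smul, smul_eq_mul, div_mul_cancel₀ _ huy]
      have e2 : a' * b y ((d / b u y) • u) = -(a' * d) := by
        rw [map_smul, smul_eq_mul, ← h5, mul_neg, div_mul_cancel₀ _ huy, mul_neg]
      rw [e1] at h1
      rw [e2, map_neg] at h2
      rw [sub_mul, map_sub]
      linear_combination -h1 - h4 - h3 - h2
    obtain ⟨u, hu⟩ := exists_ne (0 : V)
    obtain ⟨a, ha⟩ := hlam u hu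
    have hall : ∀ x y, f x y = Algebra.trace F K (a * b x y) := by
      intro x y
      by_cases hx : x = 0
      · simp [hx]
      obtain ⟨a', ha'⟩ := hlam x hx
      have key : ∃ z, b u z ≠ 0 ∧ b x z ≠ 0 := by
        obtain ⟨z, hz⟩ := hex u hu
        obtain ⟨w, hw⟩ := hex x hx
        by_cases h1 : b x z = 0
        · by_cases h2 : b u w = 0
          · exact ⟨z + w, by simp [hz, h2], by simp [hw, h1]⟩
          · exact ⟨w, h2, by simp [hw]⟩
        · exact ⟨z, by simp [hz], h1⟩
      obtain ⟨z, hz1, hz2⟩ := key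
      have hz : z ≠ 0 := by rintro rfl; simp at hz1
      obtain ⟨d, hd⟩ := hlam z hz
      rw [ha' y, hsame x z a' d ha' hd hz2, hsame u z a d ha hd hz1]
    refine ⟨a, ?_, LinearMap.ext₂ fun x y => hall x y⟩
    rintro rfl
    exact hf0 (LinearMap.ext₂ fun x y => by simp [hall])

variable (F V) in
/-- The subspace of `K ⊗[F] V` on which the `K`-structure of `V` acts through `φ`, that is, the
common eigenspace `{x | ∀ c, (1 ⊗ c) x = φ(c) x}`. -/
def transversal (φ : K →ₐ[F] K) : Submodule K (K ⊗[F] V) :=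
  ⨅ c : K, Module.End.eigenspace ((Algebra.lsmul F F V c).baseChange K) (φ c)

/-- Each extended line of the spread meets each of the two transversal subspaces. -/
theorem transversal_meets (hK : Module.finrank F K = 2) (φ : K →ₐ[F] K) (l : Submodule F V)
    (hl : l ∈ spread F K V) :
    ∃ x ∈ l.baseChange K, x ∈ transversal F V φ ∧ x ≠ 0 := by
  have : FiniteDimensional F K := Module.finite_of_finrank_eq_succ hK
  obtain ⟨v, hv, rfl⟩ := hl
  obtain ⟨w, hw⟩ : ∃ w : K, ∀ a : F, algebraMap F K a ≠ w := by
    by_contra! h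
    have h1 : Module.finrank F K = 1 := finrank_eq_one (1 : K) one_ne_zero fun w => by
      obtain ⟨a, ha⟩ := h w
      exact ⟨a, by rw [← ha, Algebra.algebraMap_eq_smul_one]⟩
    omega
  have hli : LinearIndependent F ![(1 : K), w] := by
    rw [LinearIndependent.pair_iff' one_ne_zero]
    intro a ha
    exact hw a (by rw [Algebra.algebraMap_eq_smul_one, ha])
  have hspan := hli.span_eq_top_of_card_eq_finrank' (by simp [hK])
  have hc : ∀ c : K, ∃ a d : F, a • (1 : K) + d • w = c := by
    intro c
    have : c ∈ Submodule.span F (Set.range ![(1 : K), w]) := by rw [hspan]; trivial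
    rwa [Matrix.range_cons_cons_empty, Submodule.mem_span_pair] at this
  obtain ⟨p, s, hps⟩ := hc (w * w)
  have hφ : φ w * φ w = p • (1 : K) + s • φ w := by
    rw [← map_mul, ← hps]; simp
  let x : K ⊗[F] V := 1 ⊗ₜ (w • v) - (s • (1 : K) - φ w) ⊗ₜ v
  refine ⟨x, ?_, ?_, ?_⟩
  · refine Submodule.sub_mem _ ?_ ?_
    · exact Submodule.tmul_mem_baseChange_of_mem _
        (Submodule.smul_mem (Submodule.span K {v}) w (Submodule.mem_span_singleton_self v))
    · exact Submodule.tmul_mem_baseChange_of_mem _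
        (show v ∈ Submodule.span K {v} from Submodule.mem_span_singleton_self v)
  · have hwx : (Algebra.lsmul F F V w).baseChange K x = φ w • x := by
      have e : w • w • v = p • v + s • w • v := by
        rw [smul_smul, ← hps, add_smul, smul_assoc, smul_assoc, one_smul]
      simp only [x, map_sub, LinearMap.baseChange_tmul, Algebra.lsmul_coe, e, smul_sub,
        TensorProduct.smul_tmul', TensorProduct.tmul_add, TensorProduct.tmul_smul,
        TensorProduct.sub_tmul, smul_eq_mul, hφ, TensorProduct.add_tmul, mul_one,
        mul_smul_comm]
      abel
    rw [transversal, Submodule.mem_iInf]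
    intro c
    rw [Module.End.mem_eigenspace_iff]
    obtain ⟨a, d, rfl⟩ := hc c
    have e1 : (Algebra.lsmul F F V (a • (1 : K) + d • w)).baseChange K x =
        a • x + d • (Algebra.lsmul F F V w).baseChange K x := by
      rw [map_add, map_smul, map_smul, map_one, LinearMap.baseChange_add,
        LinearMap.baseChange_smul, LinearMap.baseChange_smul]
      simp [Module.End.one_eq_id]
    rw [e1, hwx, map_add, map_smul, map_smul, map_one, add_smul, smul_assoc, smul_assoc, one_smul]
  · intro h0
    have hwv : w • v ∉ Submodule.span F {v} := by
      rw [Submodule.mem_span_singleton]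
      rintro ⟨a, ha⟩
      rw [← algebraMap_smul K a v] at ha
      exact hw a (smul_left_injective K hv ha)
    obtain ⟨ψ, hψ, hle⟩ := Submodule.exists_le_ker_of_notMem hwv
    have hψv : ψ v = 0 := hle (Submodule.mem_span_singleton_self v)
    have := congrArg (ψ.baseChange K) h0
    simp only [x, map_sub, LinearMap.baseChange_tmul, hψv, TensorProduct.tmul_zero, sub_zero,
      map_zero] at this
    have h2 := congrArg (TensorProduct.rid F K) this
    simp at h2
    exact hψ h2

variable (F K V) in
/-- The transversal subspace `Σ₁` of the extended lines of the spread. -/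
def sigma₁ : Submodule K (K ⊗[F] V) := transversal F V (AlgHom.id F K)

variable [Fintype F]

variable (F K V) in
/-- The transversal subspace `Σ₂ = τ(Σ₁)` of the extended lines of the spread. -/
def sigma₂ : Submodule K (K ⊗[F] V) := transversal F V (FiniteField.frobeniusAlgHom F K)

/-- The subspace `⟨P, S_P⟩`, where `S_P` is the intersection of `Σ₂` with the polar hyperplane
of `P` with respect to the Hermitian variety of `f`. -/
def joinS (f : LinearMap.BilinForm F V) (P : ℙ K (K ⊗[F] V)) : Submodule K (K ⊗[F] V) :=
  P.submodule ⊔ (polar f P ⊓ sigma₂ F K V)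

variable (K) in
/-- The set `R` of the points that lie on `⟨P, S_P⟩` for some point `P` of `Σ₁`. -/
def setR (f : LinearMap.BilinForm F V) : Set (ℙ K (K ⊗[F] V)) :=
  {Q | ∃ P : ℙ K (K ⊗[F] V), P.submodule ≤ sigma₁ F K V ∧ Q.submodule ≤ joinS f P}

end Dye

end DyeSpread

end

/-!
Multiplication `k ⊗ v ↦ k • v` and its twist `k ⊗ v ↦ k ^ q • v` identify `K ⊗[F] V` with `V × V`,
in such a way that `Σ₁` is the first factor, `Σ₂` is the second one, and a scalar `a` acts as
`(a, a ^ q)` (`coord_bijective`, `mem_sigma₁_iff`, `mem_sigma₂_iff`). Since `Tr z = z + z ^ q`, the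
form of the pencil with parameter `c` becomes
`h((v, w), (v', w')) = c b(v, w') + (c b(w, v')) ^ q` (`sesq_traceForm`). So `Σ₁` and `Σ₂` are
totally isotropic, and the polar hyperplane of `P = ⟨(p, 0)⟩` is `b(w, p) = 0`, whatever `c` is. The
subspace `⟨P, S_P⟩` is `⟨p⟩ × p ^ ⊥`, which is its own perp for `h` because `p ^ ⊥ ^ ⊥ = ⟨p⟩`
(`isGenerator_joinS`), and `R` consists of the points `⟨(v, w)⟩` with `b(v, w) = 0`
(`mk_mem_setR`).

The tightness is then a count of the pairs `(v, w)` with `b(v, w) = 0` and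
`c b(v, u') + (c b(w, u)) ^ q = 0`, for a point `⟨(u, u')⟩` (`natCard_orthogonal_pairs`). Let
`s = q ^ 2` and `dim V = k + 2`. By symmetry let `u ≠ 0`; the second equation prescribes `b(u, w)` in
terms of `v`. Each `v ∉ ⟨u⟩` admits `s ^ k` vectors `w`. A vector `v ∈ ⟨u⟩` admits `s ^ (k + 1)` of
them if `v = 0` or `b(u, u') = 0`, and none otherwise. The total is `s ^ (2 k + 2)` if
`b(u, u') ≠ 0` and `s ^ (2 k + 2) + s ^ (k + 1) (s - 1)` if `b(u, u') = 0`; removing the zero vector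
and dividing by `s - 1` gives the two intersection numbers of a tight set. -/

namespace DyeSpread

/-! ### Counting over finite fields -/

/-- All fibres of a surjective additive map have the same size. -/
theorem natCard_fiber_mul_natCard {G M : Type*} [AddCommGroup G] [AddCommGroup M] [Finite G]
    (L : G →+ M) (hL : Function.Surjective L) (y : M) :
    Nat.card {x // L x = y} * Nat.card M = Nat.card G := by
  classical
  have := Fintype.ofFinite G
  have : Finite M := Finite.of_surjective L hL
  have := Fintype.ofFinite M
  rw [Nat.card_congr (Equiv.sigmaFiberEquiv L).symm, Nat.card_sigma,
    Finset.sum_congr rfl (g := fun _ => Nat.card {x // L x = y}), Finset.sum_const,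
    Finset.card_univ, Nat.card_eq_fintype_card (α := M), smul_eq_mul, mul_comm]
  intro z _
  have := AddMonoidHom.card_fiber_eq_of_mem_range L (hL z) (hL y)
  rw [Nat.card_eq_fintype_card, Nat.card_eq_fintype_card, Fintype.card_subtype,
    Fintype.card_subtype, this]

/-- A set of points of a projective space and the cone over it determine each other's size. -/
theorem natCard_cone {K W : Type*} [Field K] [Finite K] [AddCommGroup W] [Module K W] [Finite W]
    (X : Set (ℙ K W)) (C : Set W) (h0 : (0 : W) ∈ C)
    (h : ∀ (w : W) (hw : w ≠ 0), Projectivization.mk K w hw ∈ X ↔ w ∈ C) :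
    C.ncard = X.ncard * (Nat.card K - 1) + 1 := by
  let e := Projectivization.nonZeroEquivProjectivizationProdUnits K W
  have he : ∀ w : {w : W // w ≠ 0}, (e w).1 = Projectivization.mk K w.1 w.2 := fun w => rfl
  have e1 : {w : {w : W // w ≠ 0} // w.1 ∈ C} ≃ {p : ℙ K W × Kˣ // p.1 ∈ X} :=
    e.subtypeEquiv fun w => by rw [he, h]
  have e2 : {p : ℙ K W × Kˣ // p.1 ∈ X} ≃ X × Kˣ := Equiv.prodSubtypeFstEquivSubtypeProd
  have e3 : {w : {w : W // w ≠ 0} // w.1 ∈ C} ≃ (C \ {0} : Set W) :=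
    (Equiv.subtypeSubtypeEquivSubtypeInter (fun w : W => w ≠ 0) (fun w => w ∈ C)).trans
      (Equiv.subtypeEquivRight fun w => by simp [and_comm])
  have := Nat.card_congr (e3.symm.trans (e1.trans e2))
  rw [Nat.card_prod, Nat.card_coe_set_eq, Nat.card_coe_set_eq, Nat.card_units] at this
  rw [← this, Set.ncard_sdiff_singleton_add_one h0 C.toFinite]

/-! ### Symplectic spaces -/

section Symplectic

variable {K V : Type*} [Field K] [AddCommGroup V] [Module K V] [FiniteDimensional K V]
  {b : LinearMap.BilinForm K V}

/-- A line `⟨u⟩` is its own double perp. -/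
theorem exists_apply_eq_zero_apply_eq_one (hb : b.IsAlt) (hbn : b.Nondegenerate) {u v : V}
    (hv : v ∉ Submodule.span K {u}) : ∃ s, b u s = 0 ∧ b v s = 1 := by
  obtain ⟨φ, hφ, hle⟩ := Submodule.exists_le_ker_of_notMem hv
  have hu : φ u = 0 := hle (Submodule.mem_span_singleton_self u)
  have h : ∀ z, b z ((b.toDual hbn).symm φ) = - φ z := fun z => by
    rw [← hb.neg_eq, LinearMap.BilinForm.apply_toDual_symm_apply]
  exact ⟨(-(φ v)⁻¹) • (b.toDual hbn).symm φ, by simp [h, hu], by simp [h, hφ]⟩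

theorem exists_apply_eq_one (hb : b.IsAlt) (hbn : b.Nondegenerate) {u : V} (hu : u ≠ 0) :
    ∃ s, b u s = 1 := by
  obtain ⟨s, -, hs⟩ := exists_apply_eq_zero_apply_eq_one (u := 0) hb hbn (v := u) (by simpa)
  exact ⟨s, hs⟩

theorem natCard_hyperplane [Finite K] (hb : b.IsAlt) (hbn : b.Nondegenerate) {u : V} (hu : u ≠ 0)
    (x : K) : Nat.card {w // b u w = x} * Nat.card K = Nat.card V := by
  have : Finite V := Module.finite_of_finite K
  refine natCard_fiber_mul_natCard (b u).toAddMonoidHom (fun y => ?_) x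
  obtain ⟨s, hs⟩ := exists_apply_eq_one hb hbn hu
  exact ⟨y • s, by simp [hs]⟩

theorem natCard_hyperplane_inter [Finite K] (hb : b.IsAlt) (hbn : b.Nondegenerate) {u v : V}
    (hu : u ≠ 0) (hv : v ∉ Submodule.span K {u}) (x y : K) :
    Nat.card {w // b v w = x ∧ b u w = y} * (Nat.card K * Nat.card K) = Nat.card V := by
  have : Finite V := Module.finite_of_finite K
  have hu' : u ∉ Submodule.span K {v} := by
    intro h
    obtain ⟨a, rfl⟩ := Submodule.mem_span_singleton.1 h
    have ha : a ≠ 0 := by rintro rfl; simp at hu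
    exact hv (Submodule.mem_span_singleton.2 ⟨a⁻¹, by simp [ha]⟩)
  obtain ⟨s, hs0, hs1⟩ := exists_apply_eq_zero_apply_eq_one hb hbn hv
  obtain ⟨t, ht0, ht1⟩ := exists_apply_eq_zero_apply_eq_one hb hbn hu'
  have := natCard_fiber_mul_natCard ((b v).prod (b u)).toAddMonoidHom
    (fun z => ⟨z.1 • s + z.2 • t, by simp [hs0, hs1, ht0, ht1]⟩) (x, y)
  rw [Nat.card_prod] at this
  rw [← this]
  simp

/-- The number of pairs of orthogonal vectors `(v, w)` such that `b u w = φ v`, where `φ` vanishes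
either on all of the line `⟨u⟩` or only at the zero vector of it. For `v ∉ ⟨u⟩` the vectors `w`
form a coset of `⟨u, v⟩ ^ ⊥`; for `v ∈ ⟨u⟩` the first condition on `w` is
void or says `b u w = 0`, so that the two are compatible only if `φ v = 0`. -/
theorem natCard_orthogonal_pairs [Finite K] (hb : b.IsAlt) (hbn : b.Nondegenerate) {k : ℕ}
    (hV : Module.finrank K V = k + 2) {u : V} (hu : u ≠ 0) (φ : V → K) (h0 : φ 0 = 0) :
    ((∀ a : K, φ (a • u) = 0) → Nat.card {p : V × V // b p.1 p.2 = 0 ∧ b u p.2 = φ p.1} +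
      Nat.card K ^ (k + 1) = Nat.card K ^ (2 * k + 2) + Nat.card K ^ (k + 2)) ∧
    ((∀ a : K, a ≠ 0 → φ (a • u) ≠ 0) →
      Nat.card {p : V × V // b p.1 p.2 = 0 ∧ b u p.2 = φ p.1} = Nat.card K ^ (2 * k + 2)) := by
  classical
  have : Finite V := Module.finite_of_finite K
  have := Fintype.ofFinite V
  have hcV : Nat.card V = Nat.card K ^ (k + 2) := by rw [Module.natCard_eq_pow_finrank (K := K), hV]
  have hs : 0 < Nat.card K := Nat.card_pos
  set s := Nat.card K with hsdef
  have hN := Nat.card_congr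
    (Equiv.subtypeProdEquivSigmaSubtype fun v w : V => b v w = 0 ∧ b u w = φ v)
  rw [Nat.card_sigma, ← Finset.sum_filter_add_sum_filter_not _ (· ∈ Submodule.span K {u})] at hN
  have hspan : (Finset.univ.filter (· ∈ Submodule.span K {u})).card = s := by
    rw [← Fintype.card_subtype, ← Nat.card_eq_fintype_card]
    exact (Nat.card_congr (LinearEquiv.toSpanNonzeroSingleton K V u hu).toEquiv).symm
  have hnot : (Finset.univ.filter (· ∉ Submodule.span K {u})).card + s = s ^ (k + 2) := by
    have := Finset.card_filter_add_card_filter_not (s := (Finset.univ : Finset V))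
      (· ∈ Submodule.span K {u})
    rw [hspan, Finset.card_univ, ← Nat.card_eq_fintype_card, hcV] at this
    omega
  have hout : ∑ v ∈ Finset.univ.filter (· ∉ Submodule.span K {u}),
      Nat.card {w // b v w = 0 ∧ b u w = φ v} + s ^ (k + 1) = s ^ (2 * k + 2) := by
    rw [Finset.sum_congr rfl (g := fun _ => s ^ k), Finset.sum_const, smul_eq_mul, pow_succ',
      ← add_mul, hnot]
    · ring
    · intro v hv
      have := natCard_hyperplane_inter hb hbn hu (Finset.mem_filter.1 hv).2 0 (φ v)
      rw [hcV, ← hsdef, pow_add, sq] at this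
      exact Nat.eq_of_mul_eq_mul_right (by positivity) this
  have hplane : Nat.card {w // b u w = 0} = s ^ (k + 1) := by
    have := natCard_hyperplane hb hbn hu 0
    rw [hcV, ← hsdef, pow_succ] at this
    exact Nat.eq_of_mul_eq_mul_right hs this
  rw [hN]
  constructor
  · intro hφ
    rw [Finset.sum_eq_card_nsmul (b := s ^ (k + 1)), hspan, add_assoc, hout, smul_eq_mul]
    · ring
    · intro v hv
      obtain ⟨a, rfl⟩ := Submodule.mem_span_singleton.1 (Finset.mem_filter.1 hv).2
      rw [← hplane]
      refine Nat.card_congr (Equiv.subtypeEquivRight fun w => ?_)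
      rw [hφ]
      exact ⟨fun h => h.2, fun h => ⟨by simp [h], h⟩⟩
  · intro hφ
    rw [Finset.sum_eq_single 0, add_comm, ← hout]
    · congr 1
      rw [← hplane]
      exact Nat.card_congr (Equiv.subtypeEquivRight fun w => by simp [h0])
    · intro v hv hv0
      obtain ⟨a, rfl⟩ := Submodule.mem_span_singleton.1 (Finset.mem_filter.1 hv).2
      have ha : a ≠ 0 := by rintro rfl; simp at hv0
      rw [Nat.card_eq_zero]
      left
      refine ⟨fun w => hφ a ha ?_⟩
      have h1 : b u w.1 = 0 := by simpa [ha] using w.2.1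
      rw [← w.2.2, h1]
    · simp

end Symplectic

/-! ### Coordinates on the extension -/

section Coordinates

variable {F K V : Type*} [Field F] [Field K] [Algebra F K]
  [AddCommGroup V] [Module F V] [Module K V] [IsScalarTower F K V]

variable (F K V) in
/-- The multiplication map `K ⊗[F] V → V`, `k ⊗ v ↦ k • v`, with kernel `Σ₂`. -/
noncomputable def mulMap : K ⊗[F] V →ₗ[F] V :=
  TensorProduct.lift (Algebra.lsmul F F V : K →ₐ[F] _).toLinearMap

@[simp] theorem mulMap_tmul (k : K) (v : V) : mulMap F K V (k ⊗ₜ v) = k • v := rfl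

@[simp] theorem mulMap_smul (c : K) (x : K ⊗[F] V) :
    mulMap F K V (c • x) = c • mulMap F K V x := by
  induction x with
  | zero => simp
  | add x y hx hy => simp only [smul_add, map_add, hx, hy]
  | tmul k v => simp [TensorProduct.smul_tmul', mul_smul]

theorem mulMap_lsmul (c : K) (x : K ⊗[F] V) :
    mulMap F K V ((Algebra.lsmul F F V c).baseChange K x) = c • mulMap F K V x := by
  induction x with
  | zero => simp
  | add x y hx hy => simp only [smul_add, map_add, hx, hy]
  | tmul k v => simp [smul_comm c k v]

variable [Fintype F]

variable (F K V) in
/-- The twisted multiplication map `K ⊗[F] V → V`, `k ⊗ v ↦ k ^ q • v`, with kernel `Σ₁`. -/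
noncomputable def conjMulMap : K ⊗[F] V →ₗ[F] V := mulMap F K V ∘ₗ tau F K V

@[simp] theorem conjMulMap_tmul (k : K) (v : V) :
    conjMulMap F K V (k ⊗ₜ v) = k ^ Fintype.card F • v := rfl

@[simp] theorem conjMulMap_smul (c : K) (x : K ⊗[F] V) :
    conjMulMap F K V (c • x) = c ^ Fintype.card F • conjMulMap F K V x := by
  induction x with
  | zero => simp
  | add x y hx hy => simp only [smul_add, map_add, hx, hy]
  | tmul k v => simp [TensorProduct.smul_tmul', mul_smul, mul_pow]

theorem conjMulMap_lsmul (c : K) (x : K ⊗[F] V) :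
    conjMulMap F K V ((Algebra.lsmul F F V c).baseChange K x) = c • conjMulMap F K V x := by
  induction x with
  | zero => simp
  | add x y hx hy => simp only [smul_add, map_add, hx, hy]
  | tmul k v => simp [smul_comm c _ v]

theorem natCard_eq_sq (hK : Module.finrank F K = 2) : Nat.card K = Fintype.card F ^ 2 := by
  have : FiniteDimensional F K := Module.finite_of_finrank_eq_succ hK
  rw [Module.natCard_eq_pow_finrank (K := F), hK, Nat.card_eq_fintype_card]

theorem pow_card_pow_card (hK : Module.finrank F K = 2) (a : K) :
    (a ^ Fintype.card F) ^ Fintype.card F = a := by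
  have : FiniteDimensional F K := Module.finite_of_finrank_eq_succ hK
  have : Finite K := Module.finite_of_finite F
  have := Fintype.ofFinite K
  rw [← pow_mul, ← sq, ← natCard_eq_sq hK, Nat.card_eq_fintype_card, FiniteField.pow_card]

theorem exists_pow_card_ne (hK : Module.finrank F K = 2) : ∃ w : K, w ^ Fintype.card F ≠ w := by
  by_contra! h
  have : FiniteDimensional F K := Module.finite_of_finrank_eq_succ hK
  have : Finite K := Module.finite_of_finite F
  have := Fintype.ofFinite K
  have h1 : 1 < Fintype.card F := Fintype.one_lt_card
  have h2 := Polynomial.card_roots' (Polynomial.X ^ Fintype.card F - Polynomial.X : Polynomial K)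
  have hne := FiniteField.X_pow_card_sub_X_ne_zero K h1
  rw [FiniteField.X_pow_card_sub_X_natDegree_eq K h1] at h2
  have h3 : Fintype.card K ≤ _ := Multiset.card_le_card
    ((Multiset.le_iff_subset (Finset.univ : Finset K).nodup).2 fun x _ =>
      (Polynomial.mem_roots hne).2 (by simp [h x]))
  have h4 := natCard_eq_sq hK
  rw [Nat.card_eq_fintype_card] at h4
  nlinarith

variable (F K V) in
/-- The two multiplication maps are the coordinates of the decomposition
`K ⊗[F] V = Σ₁ ⊕ Σ₂ ≅ V × V`. -/
noncomputable def coord : K ⊗[F] V →ₗ[F] V × V := (mulMap F K V).prod (conjMulMap F K V)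

theorem coord_bijective (hK : Module.finrank F K = 2) [FiniteDimensional K V] :
    Function.Bijective (coord F K V) := by
  have : FiniteDimensional F K := Module.finite_of_finrank_eq_succ hK
  have : FiniteDimensional F V := Module.Finite.trans K V
  have hs : Function.Surjective (coord F K V) := by
    rintro ⟨v, w⟩
    obtain ⟨e, he⟩ := exists_pow_card_ne hK
    have he' : e - e ^ Fintype.card F ≠ 0 := sub_ne_zero.2 he.symm
    -- `1 ⊗ u + e ⊗ u'` has coordinates `u + e u'` and `u + e ^ q u'`
    let u' := (e - e ^ Fintype.card F)⁻¹ • (v - w)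
    have hu' : e • u' - e ^ Fintype.card F • u' = v - w := by
      rw [← sub_smul, smul_inv_smul₀ he']
    refine ⟨1 ⊗ₜ (v - e • u') + e ⊗ₜ u', Prod.ext ?_ ?_⟩
    · simp [coord]
    · change conjMulMap F K V _ = w
      rw [map_add, conjMulMap_tmul, conjMulMap_tmul, one_pow, one_smul, sub_add]
      rw [hu', sub_sub_cancel]
  refine ⟨(LinearMap.injective_iff_surjective_of_finrank_eq_finrank ?_).2 hs, hs⟩
  rw [Module.finrank_tensorProduct, hK, Module.finrank_prod, two_mul]

theorem eq_of_mulMap_eq (hK : Module.finrank F K = 2) [FiniteDimensional K V] {x y : K ⊗[F] V}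
    (h1 : mulMap F K V x = mulMap F K V y) (h2 : conjMulMap F K V x = conjMulMap F K V y) :
    x = y :=
  (coord_bijective hK).1 (Prod.ext h1 h2)

theorem exists_mulMap_eq (hK : Module.finrank F K = 2) [FiniteDimensional K V] (v w : V) :
    ∃ x, mulMap F K V x = v ∧ conjMulMap F K V x = w := by
  obtain ⟨x, hx⟩ := (coord_bijective hK).2 (v, w)
  exact ⟨x, congrArg Prod.fst hx, congrArg Prod.snd hx⟩

theorem mem_sigma₁_iff (hK : Module.finrank F K = 2) [FiniteDimensional K V] (x : K ⊗[F] V) :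
    x ∈ sigma₁ F K V ↔ conjMulMap F K V x = 0 := by
  simp only [sigma₁, transversal, Submodule.mem_iInf, Module.End.mem_eigenspace_iff]
  constructor
  · intro h
    obtain ⟨e, he⟩ := exists_pow_card_ne hK
    have := congrArg (conjMulMap F K V) (h e)
    rw [conjMulMap_lsmul, conjMulMap_smul, eq_comm, ← sub_eq_zero, ← sub_smul] at this
    exact (smul_eq_zero.1 this).resolve_left (sub_ne_zero.2 he)
  · intro h c
    apply eq_of_mulMap_eq hK <;> simp [mulMap_lsmul, conjMulMap_lsmul, h]

theorem mem_sigma₂_iff (hK : Module.finrank F K = 2) [FiniteDimensional K V] (x : K ⊗[F] V) :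
    x ∈ sigma₂ F K V ↔ mulMap F K V x = 0 := by
  simp only [sigma₂, transversal, Submodule.mem_iInf, Module.End.mem_eigenspace_iff]
  constructor
  · intro h
    obtain ⟨e, he⟩ := exists_pow_card_ne hK
    have := congrArg (mulMap F K V) (h e)
    rw [mulMap_lsmul, mulMap_smul, eq_comm, ← sub_eq_zero, ← sub_smul] at this
    exact (smul_eq_zero.1 this).resolve_left (sub_ne_zero.2 he)
  · intro h c
    apply eq_of_mulMap_eq hK <;> simp [mulMap_lsmul, conjMulMap_lsmul, pow_card_pow_card hK, h]

/-! ### The Hermitian forms of the pencil in coordinates -/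

/-- In the coordinates `(v, w)` of `K ⊗[F] V`, the form of the pencil with parameter `c` pairs the
two totally isotropic subspaces `Σ₁` and `Σ₂` by the single form `b`. -/
theorem sesq_traceForm (hK : Module.finrank F K = 2) (b : LinearMap.BilinForm K V) (c : K)
    (x y : K ⊗[F] V) :
    sesq (traceForm F b c) x y = c * b (mulMap F K V x) (conjMulMap F K V y) +
      (c * b (conjMulMap F K V x) (mulMap F K V y)) ^ Fintype.card F := by
  have : FiniteDimensional F K := Module.finite_of_finrank_eq_succ hK
  have : Finite K := Module.finite_of_finite F
  have hadd : ∀ a c : K, (a + c) ^ Fintype.card F = a ^ Fintype.card F + c ^ Fintype.card F :=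
    fun a c => map_add (FiniteField.frobeniusAlgHom F K) a c
  induction x with
  | zero => simp [sesq, Fintype.card_ne_zero]
  | add x x' hx hx' =>
    have e1 : sesq (traceForm F b c) (x + x') y =
        sesq (traceForm F b c) x y + sesq (traceForm F b c) x' y := by simp [sesq]
    rw [e1, hx, hx']
    simp only [map_add, LinearMap.add_apply, mul_add, hadd]; ring
  | tmul k v =>
    induction y with
    | zero => simp [sesq, Fintype.card_ne_zero]
    | add y y' hy hy' =>
      have e1 : sesq (traceForm F b c) (k ⊗ₜ[F] v) (y + y') =
          sesq (traceForm F b c) (k ⊗ₜ v) y + sesq (traceForm F b c) (k ⊗ₜ v) y' := by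
        simp [sesq]
      rw [e1, hy, hy']
      simp only [map_add, mul_add, hadd]; ring
    | tmul l w =>
      have h1 : sesq (traceForm F b c) (k ⊗ₜ[F] v) (l ⊗ₜ[F] w) =
          algebraMap F K (Algebra.trace F K (c * b v w)) * (k * l ^ Fintype.card F) := by
        rw [← Algebra.smul_def]; simp [sesq, tau, traceForm]
      rw [h1, FiniteField.algebraMap_trace_eq_sum_pow, hK]
      simp only [Finset.sum_range_succ, Finset.sum_range_zero, mulMap_tmul, conjMulMap_tmul,
        map_smul, LinearMap.smul_apply, smul_eq_mul, mul_pow, pow_card_pow_card hK,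
        Nat.card_eq_fintype_card]
      ring

section Pencil

variable {b : LinearMap.BilinForm K V} {c : K}

theorem polar_mk (b : LinearMap.BilinForm K V) (hK : Module.finrank F K = 2) (c : K)
    {y : K ⊗[F] V} (hy : y ≠ 0) (x : K ⊗[F] V) :
    x ∈ polar (traceForm F b c) (Projectivization.mk K y hy) ↔
      c * b (mulMap F K V x) (conjMulMap F K V y) +
        (c * b (conjMulMap F K V x) (mulMap F K V y)) ^ Fintype.card F = 0 := by
  rw [← sesq_traceForm hK]
  constructor
  · exact fun h => h y (by simp [Projectivization.submodule_mk])
  · intro h z hz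
    rw [Projectivization.submodule_mk] at hz
    obtain ⟨a, rfl⟩ := Submodule.mem_span_singleton.1 hz
    rw [sesq_traceForm hK] at h ⊢
    simp only [conjMulMap_smul, mulMap_smul, map_smul, smul_eq_mul]
    linear_combination a ^ Fintype.card F * h

/-- The polar hyperplane of a point of `Σ₁` does not depend on the member of the pencil. -/
theorem polar_mk_sigma₁ (b : LinearMap.BilinForm K V) (hK : Module.finrank F K = 2) (hc : c ≠ 0)
    {p : K ⊗[F] V} (hp : p ≠ 0) (hp1 : conjMulMap F K V p = 0) (x : K ⊗[F] V) :
    x ∈ polar (traceForm F b c) (Projectivization.mk K p hp) ↔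
      b (conjMulMap F K V x) (mulMap F K V p) = 0 := by
  simp [polar_mk b hK, hp1, hc, Fintype.card_ne_zero]

variable [FiniteDimensional K V]

/-- In coordinates, `⟨P, S_P⟩` is the product of the point `P` and its perp with respect to `b`. -/
theorem mem_joinS_mk (b : LinearMap.BilinForm K V) (hK : Module.finrank F K = 2) (hc : c ≠ 0)
    {p : K ⊗[F] V} (hp : p ≠ 0) (hp1 : conjMulMap F K V p = 0) (x : K ⊗[F] V) :
    x ∈ joinS (traceForm F b c) (Projectivization.mk K p hp) ↔
      mulMap F K V x ∈ Submodule.span K {mulMap F K V p} ∧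
        b (conjMulMap F K V x) (mulMap F K V p) = 0 := by
  rw [joinS, Submodule.mem_sup]
  simp only [Projectivization.submodule_mk, Submodule.mem_inf, mem_sigma₂_iff hK,
    polar_mk_sigma₁ b hK hc hp hp1]
  constructor
  · rintro ⟨y, hy, t, ⟨ht, ht2⟩, rfl⟩
    obtain ⟨a, rfl⟩ := Submodule.mem_span_singleton.1 hy
    simp only [map_add, mulMap_smul, conjMulMap_smul, ht2, hp1, smul_zero, add_zero, zero_add, ht]
    exact ⟨Submodule.smul_mem _ _ (Submodule.mem_span_singleton_self _), trivial⟩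
  · rintro ⟨h1, h2⟩
    obtain ⟨a, ha⟩ := Submodule.mem_span_singleton.1 h1
    refine ⟨a • p, Submodule.smul_mem _ _ (Submodule.mem_span_singleton_self _), x - a • p,
      ⟨?_, ?_⟩, by abel⟩
    · simpa [hp1] using h2
    · simp [ha]

/-- The points of `setR` are those with orthogonal coordinates. -/
theorem mk_mem_setR (hb : b.IsAlt) (hK : Module.finrank F K = 2) (hc : c ≠ 0) {x : K ⊗[F] V}
    (hx : x ≠ 0) : Projectivization.mk K x hx ∈ setR K (traceForm F b c) ↔
      b (mulMap F K V x) (conjMulMap F K V x) = 0 := by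
  simp only [setR, Set.mem_ofPred_eq, Projectivization.submodule_mk,
    Submodule.span_singleton_le_iff_mem]
  constructor
  · rintro ⟨P, hP, hxP⟩
    induction P using Projectivization.ind with | _ p hp
    rw [Projectivization.submodule_mk, Submodule.span_singleton_le_iff_mem, mem_sigma₁_iff hK] at hP
    obtain ⟨h1, h2⟩ := (mem_joinS_mk b hK hc hp hP x).1 hxP
    obtain ⟨a, ha⟩ := Submodule.mem_span_singleton.1 h1
    rw [← ha, map_smul, LinearMap.smul_apply, ← hb.neg_eq, h2]; simp
  · intro h
    obtain ⟨u, hu, hxu, hu2⟩ : ∃ u : V, u ≠ 0 ∧ mulMap F K V x ∈ Submodule.span K {u} ∧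
        b (conjMulMap F K V x) u = 0 := by
      by_cases h0 : mulMap F K V x = 0
      · exact ⟨conjMulMap F K V x, fun h1 => hx (eq_of_mulMap_eq hK (by simpa) (by simpa)),
          by simp [h0], hb _⟩
      · exact ⟨_, h0, Submodule.mem_span_singleton_self _, by rw [← hb.neg_eq, h, neg_zero]⟩
    obtain ⟨p, rfl, hp2⟩ := exists_mulMap_eq (F := F) hK u 0
    have hp : p ≠ 0 := by rintro rfl; simp at hu
    refine ⟨Projectivization.mk K p hp, ?_, (mem_joinS_mk b hK hc hp hp2 x).2 ⟨hxu, hu2⟩⟩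
    rwa [Projectivization.submodule_mk, Submodule.span_singleton_le_iff_mem, mem_sigma₁_iff hK]

end Pencil
end Coordinates

/-! ### The size of a polar section -/

theorem theta_mul_add_one {s : ℕ} (hs : 0 < s) (k : ℕ) : theta k s * (s - 1) + 1 = s ^ (k + 1) := by
  obtain ⟨t, rfl⟩ := Nat.exists_eq_add_of_lt hs
  simp only [theta, zero_add, Nat.add_sub_cancel]
  exact geom_sum_mul_add t (k + 1)

section PolarSection

variable {F K V : Type*} [Field F] [Fintype F] [Field K] [Algebra F K]
  [AddCommGroup V] [Module K V] [FiniteDimensional K V]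
  {b : LinearMap.BilinForm K V} {c : K}

theorem add_pow_card_eq_zero_iff (hK : Module.finrank F K = 2) (y z : K) :
    z + y ^ Fintype.card F = 0 ↔ y + z ^ Fintype.card F = 0 := by
  have hadd : ∀ a c : K, (a + c) ^ Fintype.card F = a ^ Fintype.card F + c ^ Fintype.card F :=
    fun a c => map_add (FiniteField.frobeniusAlgHom F K) a c
  rw [← pow_eq_zero_iff (n := Fintype.card F) Fintype.card_ne_zero, hadd, pow_card_pow_card hK,
    add_comm]

theorem natCard_setR_inter_polar_of_ne_zero (hK : Module.finrank F K = 2) (hb : b.IsAlt)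
    (hbn : b.Nondegenerate) {k : ℕ} (hV : Module.finrank K V = k + 2) (hc : c ≠ 0) {u : V}
    (hu : u ≠ 0) (u' : V) :
    (b u u' = 0 → Nat.card {p : V × V // b p.1 p.2 = 0 ∧
        c * b p.1 u' + (c * b p.2 u) ^ Fintype.card F = 0} + Nat.card K ^ (k + 1) =
      Nat.card K ^ (2 * k + 2) + Nat.card K ^ (k + 2)) ∧
    (b u u' ≠ 0 → Nat.card {p : V × V // b p.1 p.2 = 0 ∧
        c * b p.1 u' + (c * b p.2 u) ^ Fintype.card F = 0} = Nat.card K ^ (2 * k + 2)) := by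
  have : FiniteDimensional F K := Module.finite_of_finrank_eq_succ hK
  have : Finite K := Module.finite_of_finite F
  have hq : Fintype.card F ≠ 0 := Fintype.card_ne_zero
  let φ : V → K := fun v => c⁻¹ * (c * b v u') ^ Fintype.card F
  have hφ : Nat.card {p : V × V // b p.1 p.2 = 0 ∧
      c * b p.1 u' + (c * b p.2 u) ^ Fintype.card F = 0} =
      Nat.card {p : V × V // b p.1 p.2 = 0 ∧ b u p.2 = φ p.1} := by
    refine Nat.card_congr (Equiv.subtypeEquivRight fun p => and_congr_right fun _ => ?_)
    rw [add_pow_card_eq_zero_iff hK, ← hb.neg_eq, eq_inv_mul_iff_mul_eq₀ hc, mul_neg,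
      neg_add_eq_zero]
  have := natCard_orthogonal_pairs hb hbn hV hu φ (by simp [φ, hq])
  rw [hφ]
  exact ⟨fun h => this.1 fun a => by simp [φ, h, hq],
    fun h => this.2 fun a ha => by simp [φ, h, ha, hc, hq]⟩

/-- The number of vectors in the cone over the points of `setR` in the polar hyperplane of the
point with coordinates `(u, u')`. The interchange of the two coordinates allows for `u ≠ 0`. -/
theorem natCard_setR_inter_polar (hK : Module.finrank F K = 2) (hb : b.IsAlt)
    (hbn : b.Nondegenerate) {k : ℕ} (hV : Module.finrank K V = k + 2) (hc : c ≠ 0) {u u' : V}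
    (hu : u ≠ 0 ∨ u' ≠ 0) :
    (b u u' = 0 → Nat.card {p : V × V // b p.1 p.2 = 0 ∧
        c * b p.1 u' + (c * b p.2 u) ^ Fintype.card F = 0} + Nat.card K ^ (k + 1) =
      Nat.card K ^ (2 * k + 2) + Nat.card K ^ (k + 2)) ∧
    (b u u' ≠ 0 → Nat.card {p : V × V // b p.1 p.2 = 0 ∧
        c * b p.1 u' + (c * b p.2 u) ^ Fintype.card F = 0} = Nat.card K ^ (2 * k + 2)) := by
  by_cases h : u = 0
  · have hu' := hu.resolve_left (not_not_intro h)
    have hcongr : Nat.card {p : V × V // b p.1 p.2 = 0 ∧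
        c * b p.1 u' + (c * b p.2 u) ^ Fintype.card F = 0} = Nat.card {p : V × V // b p.1 p.2 = 0 ∧
        c * b p.1 u + (c * b p.2 u') ^ Fintype.card F = 0} :=
      Nat.card_congr ((Equiv.prodComm V V).subtypeEquiv fun p => by
        rw [add_pow_card_eq_zero_iff hK, ← hb.neg_eq, neg_eq_zero]; rfl)
    have := natCard_setR_inter_polar_of_ne_zero hK hb hbn hV hc hu' u
    rw [hcongr]
    refine ⟨fun _ => this.1 (by simp [h]), fun h' => (h' (by simp [h])).elim⟩
  · exact natCard_setR_inter_polar_of_ne_zero hK hb hbn hV hc h u'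

end PolarSection

/-! ### Generators and tightness -/

section Tightness

variable {F K V : Type*} [Field F] [Fintype F] [Field K] [Algebra F K]
  [AddCommGroup V] [Module F V] [Module K V] [IsScalarTower F K V] [FiniteDimensional K V]
  {b : LinearMap.BilinForm K V} {c : K}

/-- For a point `P` of `Σ₁`, a vector orthogonal to `P` and to `S_P` lies in `⟨P, S_P⟩`, because
`P` is its own double perp with respect to `b`. -/
theorem isGenerator_joinS (hK : Module.finrank F K = 2) (hb : b.IsAlt) (hbn : b.Nondegenerate)
    {d : K} (hc : c ≠ 0) (hd : d ≠ 0) (P : ℙ K (K ⊗[F] V)) (hP : P.submodule ≤ sigma₁ F K V) :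
    IsGenerator (traceForm F b c) (joinS (traceForm F b d) P) := by
  have hq : Fintype.card F ≠ 0 := Fintype.card_ne_zero
  induction P using Projectivization.ind with | _ p hp
  rw [Projectivization.submodule_mk, Submodule.span_singleton_le_iff_mem, mem_sigma₁_iff hK] at hP
  have hmem := mem_joinS_mk b hK hd hp hP
  refine ⟨fun x hx y hy => ?_, fun T hT hle x hx => ?_⟩
  · obtain ⟨hx1, hx2⟩ := (hmem x).1 hx
    obtain ⟨hy1, hy2⟩ := (hmem y).1 hy
    obtain ⟨a, ha⟩ := Submodule.mem_span_singleton.1 hx1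
    obtain ⟨a', ha'⟩ := Submodule.mem_span_singleton.1 hy1
    have hy2' : b (mulMap F K V p) (conjMulMap F K V y) = 0 := by rw [← hb.neg_eq, hy2, neg_zero]
    rw [sesq_traceForm hK, ← ha, ← ha']
    simp [hx2, hy2', hq]
  · rw [hmem]
    constructor
    · by_contra h
      obtain ⟨s, hs0, hs1⟩ := exists_apply_eq_zero_apply_eq_one hb hbn h
      obtain ⟨y, hy1, hy2⟩ := exists_mulMap_eq (F := F) hK 0 s
      have hy : y ∈ T := hle ((hmem y).2 ⟨by simp [hy1], by rw [hy2, ← hb.neg_eq, hs0, neg_zero]⟩)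
      have := hT x hx y hy
      rw [sesq_traceForm hK, hy1, hy2, hs1] at this
      simp [hc, hq] at this
    · have hpT : p ∈ T := hle ((hmem p).2 ⟨Submodule.mem_span_singleton_self _, by simp [hP]⟩)
      have := hT x hx p hpT
      rw [sesq_traceForm hK, hP] at this
      simpa [hc] using this

theorem setR_subset_hermitianVariety (hK : Module.finrank F K = 2) (hb : b.IsAlt) {d : K}
    (hd : d ≠ 0) : setR K (traceForm F b d) ⊆ hermitianVariety K (traceForm F b c) := by
  intro P hP x hx
  induction P using Projectivization.ind with | _ p hp
  rw [mk_mem_setR hb hK hd] at hP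
  rw [Projectivization.submodule_mk] at hx
  obtain ⟨a, rfl⟩ := Submodule.mem_span_singleton.1 hx
  have hP' : b (conjMulMap F K V p) (mulMap F K V p) = 0 := by rw [← hb.neg_eq, hP, neg_zero]
  rw [sesq_traceForm hK]
  simp [hP, hP', Fintype.card_ne_zero]

/-- The vectors of the cone over `R ∩ P ^ ⊥` are, in coordinates, the pairs of orthogonal vectors
subject to the equation of the polar hyperplane. -/
theorem ncard_setR_inter_polar (hK : Module.finrank F K = 2) (hb : b.IsAlt)
    {d : K} (hd : d ≠ 0) {y : K ⊗[F] V} (hy : y ≠ 0) :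
    Nat.card {p : V × V // b p.1 p.2 = 0 ∧ c * b p.1 (conjMulMap F K V y) +
        (c * b p.2 (mulMap F K V y)) ^ Fintype.card F = 0} =
      Set.ncard {Q | Q ∈ setR K (traceForm F b d) ∧
        Q.submodule ≤ polar (traceForm F b c) (Projectivization.mk K y hy)} *
        (Nat.card K - 1) + 1 := by
  have : FiniteDimensional F K := Module.finite_of_finrank_eq_succ hK
  have : Finite K := Module.finite_of_finite F
  have : FiniteDimensional F V := Module.Finite.trans K V
  have : Finite (K ⊗[F] V) := Module.finite_of_finite K
  rw [← natCard_cone _ {x : K ⊗[F] V | b (mulMap F K V x) (conjMulMap F K V x) = 0 ∧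
      c * b (mulMap F K V x) (conjMulMap F K V y) +
        (c * b (conjMulMap F K V x) (mulMap F K V y)) ^ Fintype.card F = 0}, ← Nat.card_coe_set_eq]
  · refine (Nat.card_congr ((Equiv.ofBijective _ (coord_bijective hK)).subtypeEquiv ?_)).symm
    exact fun x => Iff.rfl
  · simp [Fintype.card_ne_zero]
  · intro x hx
    simp [mk_mem_setR hb hK hd, polar_mk b hK, Projectivization.submodule_mk,
      Submodule.span_singleton_le_iff_mem]

end Tightness

end DyeSpread

theorem mainTheorem5 {F K V : Type*} [Field F] [Fintype F] [Field K] [Algebra F K]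
    [AddCommGroup V] [Module F V] [Module K V] [IsScalarTower F K V]
    (hK : Module.finrank F K = 2) (q : ℕ) (hq : Fintype.card F = q)
    (n : ℕ) (hn : 2 ≤ n) (hV : Module.finrank K V = 2 * n)
    (b : LinearMap.BilinForm K V) (hb : b.IsAlt) (hbn : b.Nondegenerate)
    (f g : LinearMap.BilinForm F V)
    (hf : f ∈ DyeSpread.pencil F b) (hg : g ∈ DyeSpread.pencil F b) :
    (∀ P : Projectivization K (TensorProduct F K V),
      P.submodule ≤ DyeSpread.sigma₁ F K V →
        DyeSpread.polar f P = DyeSpread.polar g P ∧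
        DyeSpread.IsGenerator f (DyeSpread.joinS g P)) ∧
    DyeSpread.IsTight f (q ^ (4 * n - 2) + 1) (DyeSpread.setR K g) := by
  have hfd : FiniteDimensional K V := Module.finite_of_finrank_pos (by omega)
  obtain ⟨c, hc, rfl⟩ := hf
  obtain ⟨d, hd, rfl⟩ := hg
  refine ⟨fun P hP => ⟨?_, DyeSpread.isGenerator_joinS hK hb hbn hc hd P hP⟩, ?_⟩
  · induction P using Projectivization.ind with | _ p hp
    rw [Projectivization.submodule_mk, Submodule.span_singleton_le_iff_mem,
      DyeSpread.mem_sigma₁_iff hK] at hP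
    ext x
    rw [DyeSpread.polar_mk_sigma₁ b hK hc hp hP, DyeSpread.polar_mk_sigma₁ b hK hd hp hP]
  · obtain ⟨k, hk⟩ : ∃ k, 2 * n = k + 2 := ⟨2 * n - 2, by omega⟩
    have hFV : Module.finrank F V = 2 * (k + 2) := by
      rw [← Module.finrank_mul_finrank F K V, hK, hV, hk]
    have hsK := DyeSpread.natCard_eq_sq hK
    have hs : 0 < Nat.card K := by rw [hsK]; have := Fintype.card_pos (α := F); positivity
    have hr1 : (2 * (k + 2) - 1 - 3) / 2 = k := by omega
    have hr2 : 2 * (k + 2) - 1 - 1 = 2 * (k + 1) := by omega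
    have hr3 : 4 * n - 2 = 2 * (k + 1) := by omega
    refine ⟨DyeSpread.setR_subset_hermitianVariety hK hb hd, fun P _ => ?_⟩
    rw [hFV, ← hq, hr1, hr2, hr3, pow_mul, ← hsK]
    induction P using Projectivization.ind with | _ y hy
    have hy0 : DyeSpread.mulMap F K V y ≠ 0 ∨ DyeSpread.conjMulMap F K V y ≠ 0 := by
      by_contra! h
      exact hy (DyeSpread.eq_of_mulMap_eq hK (by simpa using h.1) (by simpa using h.2))
    have hN := DyeSpread.natCard_setR_inter_polar hK hb hbn (hV.trans hk) hc hy0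
    rw [DyeSpread.ncard_setR_inter_polar hK hb hd hy] at hN
    have hθ := DyeSpread.theta_mul_add_one hs k
    have hs1 : 1 < Nat.card K := by
      rw [hsK]; exact one_lt_pow₀ Fintype.one_lt_card two_ne_zero
    obtain ⟨t, ht⟩ : ∃ t, Nat.card K = t + 1 := ⟨Nat.card K - 1, by omega⟩
    have ht0 : 0 < t := by omega
    rw [DyeSpread.mk_mem_setR hb hK hd]
    rw [ht, Nat.add_sub_cancel] at hθ hN
    rw [ht]
    generalize DyeSpread.theta k (t + 1) = θ at hθ ⊢
    -- the points are counted by cancelling the factor `|K| - 1` from the size of the cone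
    constructor
    · intro h
      have h1 := hN.1 h
      refine Nat.eq_of_mul_eq_mul_right ht0 ?_
      rw [pow_succ _ (k + 1), show 2 * k + 2 = (k + 1) * 2 by ring, pow_mul] at h1
      rw [← hθ] at h1 ⊢
      linear_combination h1
    · intro h
      have h1 := hN.2 h
      refine Nat.eq_of_mul_eq_mul_right ht0 ?_
      rw [show 2 * k + 2 = (k + 1) * 2 by ring, pow_mul] at h1
      rw [← hθ] at h1 ⊢
      linear_combination h1
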